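/- Let $n\ge 0$. The Novikov peakon ODEs for positions $x_1(t)<\dots<x_n(t)$ and amplitudes $m_1(t),\dots,m_n(t)\in\mathbf{R}$ (of any sign) are \[ \dot x_k=\Bigl(\sum_{i=1}^n m_i e^{-|x_k-x_i|}\Bigr)^2,\qquad \dot m_k=m_k\Bigl(\sum_{i=1}^n m_i e^{-|x_k-x_i|}\Bigr)\Bigl(\sum_{j=1}^n m_j\,\operatorname{sgn}(x_k-x_j)\,e^{-|x_k-x_j|}\Bigr), \] with $\operatorname{sgn}(0)=0$. For $x_1<\dots<x_n$ and $m_1,\dots,m_n\in\mathbf{R}$ put \[ S_k(\lambda)=\begin{pmatrix}1-\lambda m_k^2&-2\lambda m_ke^{-x_k}&-\lambda^2m_k^2e^{-2x_k}\\ m_ke^{x_k}&1&\lambda m_ke^{-x_k}\\ m_k^2e^{2x_k}&2m_ke^{x_k}&1+\lambda m_k^2\end{pmatrix}, \] let $A(\lambda)$ be the $(1,1)$ entry of the product $S_n(\lambda)\cdots S_2(\lambda)S_1(\lambda)$, and let $H_k$ be the coefficient of $(-\lambda)^k$ in the polynomial $A(\lambda)$. Let $P=\operatorname{diag}(m_1,\dots,m_n)$,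 $E=(e^{-|x_j-x_k|})_{j,k=1}^n$ and $T=(1+\operatorname{sgn}(j-k))_{j,k=1}^n$. Then: 1. $H_1,\dots,H_n$ are constants of motion: each is constant along every solution of the Novikov peakon ODEs, with $x_1<\dots<x_n$, on any time interval. 2. $A(\lambda)=\sum_{k=0}^nH_k(-\lambda)^k=\det(I-\lambda\,TPEP)$ identically in $\lambda$, and $H_0=1$. 3. The matrix $PEP=(m_jm_ke^{-|x_j-x_k|})_{j,k=1}^n$ is symmetric, and for $1\le k\le n$ the constant of motion $H_k$ equals the sum $\sum_{I,J}\det\bigl((PEP)_{IJ}\bigr)$ of all $k\times k$ minors (principal and non-principal) of $PEP$, where $I,J$ run independently over the $k$-element subsets of $\{1,\dots,n\}$, rows and columns being taken in increasing order. -/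

import Mathlib

open Matrix Polynomial

noncomputable section

namespace NovikovPeakon

/-- The peakon wave profile `u(ξ) = ∑ i, m_i e^{-|ξ - x_i|}`. -/
def wave {n : ℕ} (x m : Fin n → ℝ) (ξ : ℝ) : ℝ :=
  ∑ i, m i * Real.exp (-|ξ - x i|)

/-- The average of the two one-sided limits of `u_x` at `ξ`:
`⟨u_x(ξ)⟩ = -∑ j, m_j sgn(ξ - x_j) e^{-|ξ - x_j|}`, where `sgn 0 = 0`. -/
def waveSlopeAvg {n : ℕ} (x m : Fin n → ℝ) (ξ : ℝ) : ℝ :=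
  -∑ j, m j * Real.sign (ξ - x j) * Real.exp (-|ξ - x j|)

/-- `t ↦ (x(t), m(t))` solves the Novikov peakon equations
`x_k' = u(x_k)²`, `m_k' = -m_k u(x_k) ⟨u_x(x_k)⟩` on the time set `J`, with the peakons numbered
from left to right: `x_1 < ⋯ < x_n`. The amplitudes `m_k` may have any sign. -/
structure IsSolutionOn {n : ℕ} (x m : ℝ → Fin n → ℝ) (J : Set ℝ) : Prop where
  ordered : ∀ t ∈ J, StrictMono (x t)
  position : ∀ t ∈ J, ∀ k,
    HasDerivWithinAt (fun s => x s k) (wave (x t) (m t) (x t k) ^ 2) J t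
  momentum : ∀ t ∈ J, ∀ k,
    HasDerivWithinAt (fun s => m s k)
      (-(m t k) * wave (x t) (m t) (x t k) * waveSlopeAvg (x t) (m t) (x t k)) J t

/-- A function of positions and amplitudes is a constant of motion if it is constant along every
solution of the peakon equations, on every time interval (open or not, bounded or not). -/
def IsConstantOfMotion {n : ℕ} (F : (Fin n → ℝ) → (Fin n → ℝ) → ℝ) : Prop :=
  ∀ (J : Set ℝ), J.OrdConnected → ∀ (x m : ℝ → Fin n → ℝ), IsSolutionOn x m J →
    ∀ s ∈ J, ∀ t ∈ J, F (x s) (m s) = F (x t) (m t)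

/-- The jump matrix `S(λ)` of one peakon at position `ξ` with amplitude `μ`; its entries are
polynomials in the spectral parameter `λ`, written `X`. -/
def jumpMatrix (ξ μ : ℝ) : Matrix (Fin 3) (Fin 3) ℝ[X] :=
  !![1 - C (μ ^ 2) * X, -C (2 * μ * Real.exp (-ξ)) * X, -C (μ ^ 2 * Real.exp (-2 * ξ)) * X ^ 2;
     C (μ * Real.exp ξ), 1, C (μ * Real.exp (-ξ)) * X;
     C (μ ^ 2 * Real.exp (2 * ξ)), C (2 * μ * Real.exp ξ), 1 + C (μ ^ 2) * X]

/-- The total jump matrix `S_n(λ) ⋯ S_2(λ) S_1(λ)`. -/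
def totalJumpMatrix {n : ℕ} (x m : Fin n → ℝ) : Matrix (Fin 3) (Fin 3) ℝ[X] :=
  (List.ofFn fun k => jumpMatrix (x k) (m k)).reverse.prod

/-- `A(λ)`, the `(1,1)` entry of the total jump matrix. -/
def polyA {n : ℕ} (x m : Fin n → ℝ) : ℝ[X] :=
  totalJumpMatrix x m 0 0

/-- `H_k`, the coefficient of `(-λ)^k` in `A(λ)`. -/
def H {n : ℕ} (k : ℕ) (x m : Fin n → ℝ) : ℝ :=
  (-1) ^ k * (polyA x m).coeff k

/-- `P = diag(m_1, …, m_n)`. -/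
def matP {n : ℕ} (m : Fin n → ℝ) : Matrix (Fin n) (Fin n) ℝ :=
  Matrix.diagonal m

/-- `E_{jk} = e^{-|x_j - x_k|}`. -/
def matE {n : ℕ} (x : Fin n → ℝ) : Matrix (Fin n) (Fin n) ℝ :=
  Matrix.of fun j k => Real.exp (-|x j - x k|)

/-- `T_{jk} = 1 + sgn(j - k)`: `1` on the diagonal, `2` below it, `0` above it. -/
def matT (n : ℕ) : Matrix (Fin n) (Fin n) ℝ :=
  Matrix.of fun j k => 1 + Real.sign ((j : ℝ) - (k : ℝ))

/-- The sum of all `k × k` minors `det X_{IJ}` of `X`, principal and non-principal: `I` and `J`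
run independently over the `k`-element index sets, each listed in increasing order. -/
def sumMinors {n : ℕ} (k : ℕ) (X : Matrix (Fin n) (Fin n) ℝ) : ℝ :=
  ∑ I : {I : Finset (Fin n) // I.card = k}, ∑ J : {J : Finset (Fin n) // J.card = k},
    (X.submatrix (I.1.orderEmbOfFin I.2) (J.1.orderEmbOfFin J.2)).det

end NovikovPeakon

end

/-!
With `a_k = m_k e^{-x_k}` and `b_k = m_k e^{x_k}`, the matrix `PEP` is the one-pair matrix `G`
whose entries on and below the diagonal are `a_i b_j`, and every jump matrix is polynomial in
`λ, a_k, b_k`.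

*Determinant.* `G = b aᵀ - K` with `K` strictly lower triangular, so that
`1 - λ T G = (1 + λ T K) (1 - λ y aᵀ)`, where `y` solves the triangular system
`(1 + λ T K) y = T b`. The first factor has determinant `1`, the second `1 - λ aᵀ y`. Solving the
system one index at a time is the recursion for the first column of `S_n ⋯ S_1`, and `1 - λ aᵀ y` is
its top entry.

*Minors.* Border `G` by the row and column `b` and the corner `0`. The last row of `G` is
`a_n` times the border row, so expanding along it expresses the sums of plain, row-bordered and
fully bordered minors through those of the leading block; this is the same recursion again, at
`λ = -X`.

*Constancy in time.* Between peakons the wave is `α e^x + β e^{-x}`, and the time part `V` of the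
Lax pair depends only on `α` and `β`. The peakon equations give `S_k' = V_k S_k - S_k V_{k-1}`,
which telescopes to `(S_n ⋯ S_1)' = V_n S_n ⋯ S_1 - S_n ⋯ S_1 V_0`. To the right of all peakons
`α = 0`, to the left `β = 0`, so the first row of `V_n` and the first column of `V_0` vanish, and
the `(1,1)` entry is constant for each `λ ≠ 0`, hence as a polynomial.
-/

namespace NovikovPeakon

section TransferMatrix

variable {R S : Type*} [CommRing R] [CommRing S]

/-- The jump matrix of one peakon over an arbitrary commutative ring, in terms of `a = m e^{-x}`
and `b = m e^x`; the spectral parameter `l` is an element of the ring. -/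
def transferMatrix (l a b : R) : Matrix (Fin 3) (Fin 3) R :=
  !![1 - l * a * b, -2 * l * a, -l ^ 2 * a ^ 2;
     b, 1, l * a;
     b ^ 2, 2 * b, 1 + l * a * b]

/-- The product `S_{n-1} ⋯ S_1 S_0` of the transfer matrices of a sequence of peakons. -/
def transferProduct {n : ℕ} (l : R) (a b : Fin n → R) : Matrix (Fin 3) (Fin 3) R :=
  (List.ofFn fun k => transferMatrix l (a k) (b k)).reverse.prod

@[simp]
theorem transferProduct_zero (l : R) (a b : Fin 0 → R) : transferProduct l a b = 1 := by
  simp [transferProduct]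

theorem transferProduct_succ {n : ℕ} (l : R) (a b : Fin (n + 1) → R) :
    transferProduct l a b = transferMatrix l (a (Fin.last n)) (b (Fin.last n)) *
      transferProduct l (a ∘ Fin.castSucc) (b ∘ Fin.castSucc) := by
  simp only [transferProduct, List.ofFn_succ', List.concat_eq_append, List.reverse_append,
    List.reverse_singleton, List.singleton_append, List.prod_cons, Function.comp_apply]

theorem map_transferMatrix (φ : R →+* S) (l a b : R) :
    (transferMatrix l a b).map φ = transferMatrix (φ l) (φ a) (φ b) := by
  ext i j
  fin_cases i <;> fin_cases j <;> simp [transferMatrix, map_ofNat]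

theorem map_transferProduct {n : ℕ} (φ : R →+* S) (l : R) (a b : Fin n → R) :
    (transferProduct l a b).map φ = transferProduct (φ l) (φ ∘ a) (φ ∘ b) := by
  induction n with
  | zero => simp [Matrix.map_one]
  | succ n ih =>
    rw [transferProduct_succ, transferProduct_succ, Matrix.map_mul, map_transferMatrix, ih]
    rfl

section FirstColumn

variable {n : ℕ} (l : R) (a b : Fin (n + 1) → R)

theorem transferProduct_succ_zero_zero :
    transferProduct l a b 0 0 =
      (1 - l * a (Fin.last n) * b (Fin.last n)) *
          transferProduct l (a ∘ Fin.castSucc) (b ∘ Fin.castSucc) 0 0 -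
        2 * l * a (Fin.last n) * transferProduct l (a ∘ Fin.castSucc) (b ∘ Fin.castSucc) 1 0 -
        l ^ 2 * a (Fin.last n) ^ 2 *
          transferProduct l (a ∘ Fin.castSucc) (b ∘ Fin.castSucc) 2 0 := by
  simp only [transferProduct_succ, Matrix.mul_apply, Fin.sum_univ_three, transferMatrix,
    Matrix.of_apply, Matrix.cons_val]
  ring

theorem transferProduct_succ_one_zero :
    transferProduct l a b 1 0 =
      b (Fin.last n) * transferProduct l (a ∘ Fin.castSucc) (b ∘ Fin.castSucc) 0 0 +
        transferProduct l (a ∘ Fin.castSucc) (b ∘ Fin.castSucc) 1 0 +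
        l * a (Fin.last n) * transferProduct l (a ∘ Fin.castSucc) (b ∘ Fin.castSucc) 2 0 := by
  simp only [transferProduct_succ, Matrix.mul_apply, Fin.sum_univ_three, transferMatrix,
    Matrix.of_apply, Matrix.cons_val]
  ring

theorem transferProduct_succ_two_zero :
    transferProduct l a b 2 0 =
      b (Fin.last n) ^ 2 * transferProduct l (a ∘ Fin.castSucc) (b ∘ Fin.castSucc) 0 0 +
        2 * b (Fin.last n) * transferProduct l (a ∘ Fin.castSucc) (b ∘ Fin.castSucc) 1 0 +
        (1 + l * a (Fin.last n) * b (Fin.last n)) *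
          transferProduct l (a ∘ Fin.castSucc) (b ∘ Fin.castSucc) 2 0 := by
  simp only [transferProduct_succ, Matrix.mul_apply, Fin.sum_univ_three, transferMatrix,
    Matrix.of_apply, Matrix.cons_val]

end FirstColumn

end TransferMatrix

section Determinant

variable {R : Type*} [CommRing R] {n : ℕ}

/-- The symmetric one-pair (Green's) matrix with entries `a_i b_j` for `j ≤ i`. -/
def onePairMatrix (a b : Fin n → R) : Matrix (Fin n) (Fin n) R :=
  .of fun i j => a (max i j) * b (min i j)

/-- The strictly lower triangular matrix by which the one-pair matrix differs from the rank one
matrix `b aᵀ`. -/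
def volterraMatrix (a b : Fin n → R) : Matrix (Fin n) (Fin n) R :=
  .of fun i j => if j < i then b i * a j - a i * b j else 0

variable (R n) in
/-- The matrix `1 + sgn(i - j)` over an arbitrary ring. -/
def onePlusSignMatrix : Matrix (Fin n) (Fin n) R :=
  .of fun i j => if j < i then 2 else if i = j then 1 else 0

theorem isSymm_onePairMatrix (a b : Fin n → R) : (onePairMatrix a b).IsSymm := by
  refine Matrix.IsSymm.ext fun i j => ?_
  rw [onePairMatrix, Matrix.of_apply, Matrix.of_apply, max_comm, min_comm]

theorem onePairMatrix_apply_of_le (a b : Fin n → R) {i j : Fin n} (h : j ≤ i) :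
    onePairMatrix a b i j = a i * b j := by
  rw [onePairMatrix, Matrix.of_apply, max_eq_left h, min_eq_right h]

theorem onePairMatrix_eq_vecMulVec_sub (a b : Fin n → R) :
    onePairMatrix a b = vecMulVec b a - volterraMatrix a b := by
  ext i j
  rcases lt_or_ge j i with h | h
  · simp [onePairMatrix, volterraMatrix, vecMulVec_apply, h, h.le]
  · simp [onePairMatrix, volterraMatrix, vecMulVec_apply, h, h.not_gt, mul_comm]

theorem onePlusSignMatrix_mulVec_snoc (v : Fin n → R) (r : R) :
    onePlusSignMatrix R (n + 1) *ᵥ Fin.snoc v r =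
      Fin.snoc (onePlusSignMatrix R n *ᵥ v) (2 * ∑ i, v i + r) := by
  ext i
  refine Fin.lastCases ?_ (fun i => ?_) i
  · simp [mulVec, dotProduct, Fin.sum_univ_castSucc, onePlusSignMatrix, Finset.mul_sum,
      Fin.castSucc_lt_last]
  · simp [mulVec, dotProduct, Fin.sum_univ_castSucc, onePlusSignMatrix,
      (Fin.castSucc_lt_last _).not_gt, (Fin.castSucc_lt_last _).ne]

theorem volterraMatrix_mulVec_snoc (a b : Fin (n + 1) → R) (v : Fin n → R) (r : R) :
    volterraMatrix a b *ᵥ Fin.snoc v r =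
      Fin.snoc (volterraMatrix (a ∘ Fin.castSucc) (b ∘ Fin.castSucc) *ᵥ v)
        (b (Fin.last n) * ((a ∘ Fin.castSucc) ⬝ᵥ v) -
          a (Fin.last n) * ((b ∘ Fin.castSucc) ⬝ᵥ v)) := by
  ext i
  refine Fin.lastCases ?_ (fun i => ?_) i
  · simp [mulVec, dotProduct, Fin.sum_univ_castSucc, volterraMatrix, Finset.mul_sum,
      Fin.castSucc_lt_last, sub_mul, Finset.sum_sub_distrib, mul_assoc]
  · simp [mulVec, dotProduct, Fin.sum_univ_castSucc, volterraMatrix,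
      (Fin.castSucc_lt_last _).not_gt]

theorem dotProduct_snoc (a : Fin (n + 1) → R) (v : Fin n → R) (r : R) :
    a ⬝ᵥ (Fin.snoc v r : Fin (n + 1) → R) =
      (a ∘ Fin.castSucc) ⬝ᵥ v + a (Fin.last n) * r := by
  simp [dotProduct, Fin.sum_univ_castSucc]

/-- The vector `b - l K y`, where `K` is the Volterra matrix, so that `y = T (b - l K y)` is the
linear system `(1 + l T K) y = T b`. -/
def dressedSource (l : R) (a b y : Fin n → R) : Fin n → R :=
  b - l • volterraMatrix a b *ᵥ y

theorem dressedSource_snoc (l : R) (a b : Fin (n + 1) → R) (y : Fin n → R) (r : R) :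
    dressedSource l a b (Fin.snoc y r) =
      Fin.snoc (dressedSource l (a ∘ Fin.castSucc) (b ∘ Fin.castSucc) y)
        (b (Fin.last n) * (1 - l * ((a ∘ Fin.castSucc) ⬝ᵥ y)) +
          l * a (Fin.last n) * ((b ∘ Fin.castSucc) ⬝ᵥ y)) := by
  rw [dressedSource, volterraMatrix_mulVec_snoc]
  ext i
  refine Fin.lastCases ?_ (fun i => ?_) i
  · simp
    ring
  · simp [dressedSource]

theorem exists_transferProduct_eq_dotProduct (l : R) (a b : Fin n → R) :
    ∃ y : Fin n → R, onePlusSignMatrix R n *ᵥ dressedSource l a b y = y ∧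
      transferProduct l a b 0 0 = 1 - l * (a ⬝ᵥ y) ∧
      transferProduct l a b 1 0 = ∑ i, dressedSource l a b y i ∧
      transferProduct l a b 2 0 = b ⬝ᵥ y := by
  induction n with
  | zero => exact ⟨Fin.elim0, Subsingleton.elim _ _, by simp, by simp, by simp⟩
  | succ n ih =>
    obtain ⟨y, hy, hA, hB, hC⟩ := ih (a ∘ Fin.castSucc) (b ∘ Fin.castSucc)
    set A := transferProduct l (a ∘ Fin.castSucc) (b ∘ Fin.castSucc) 0 0
    set B := transferProduct l (a ∘ Fin.castSucc) (b ∘ Fin.castSucc) 1 0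
    set D := transferProduct l (a ∘ Fin.castSucc) (b ∘ Fin.castSucc) 2 0
    refine ⟨Fin.snoc y (b (Fin.last n) * A + 2 * B + l * a (Fin.last n) * D), ?_, ?_, ?_, ?_⟩
    · rw [dressedSource_snoc, onePlusSignMatrix_mulVec_snoc, hy, ← hA, ← hB, ← hC]
      congr 1
      ring
    · rw [transferProduct_succ_zero_zero, dotProduct_snoc, mul_add, ← sub_sub, ← hA]
      ring
    · rw [transferProduct_succ_one_zero, dressedSource_snoc, ← hA, ← hC, Fin.sum_snoc, ← hB]
      ring
    · rw [transferProduct_succ_two_zero, dotProduct_snoc, ← hC]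
      ring

theorem onePlusSignMatrix_mul_volterraMatrix_apply_of_le (a b : Fin n → R) {i j : Fin n}
    (h : i ≤ j) : (onePlusSignMatrix R n * volterraMatrix a b) i j = 0 := by
  rw [Matrix.mul_apply]
  refine Finset.sum_eq_zero fun k _ => ?_
  rcases lt_or_ge i k with hik | hki
  · simp [onePlusSignMatrix, hik.not_gt, hik.ne]
  · simp [volterraMatrix, (hki.trans h).not_gt]

theorem det_one_add_smul_onePlusSignMatrix_mul_volterraMatrix (l : R) (a b : Fin n → R) :
    (1 + l • (onePlusSignMatrix R n * volterraMatrix a b)).det = 1 := by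
  rw [Matrix.det_of_isLowerTriangular]
  · refine Finset.prod_eq_one fun i _ => ?_
    simp [onePlusSignMatrix_mul_volterraMatrix_apply_of_le a b le_rfl]
  · intro i j hij
    have hij : i < j := hij
    simp [onePlusSignMatrix_mul_volterraMatrix_apply_of_le a b hij.le, hij.ne]

theorem det_one_sub_vecMulVec {ι : Type*} [Fintype ι] [DecidableEq ι] (u v : ι → R) :
    (1 - vecMulVec u v).det = 1 - v ⬝ᵥ u := by
  rw [sub_eq_add_neg, ← neg_vecMulVec, vecMulVec_eq Unit,
    det_one_add_replicateCol_mul_replicateRow, dotProduct_neg, ← sub_eq_add_neg]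

theorem det_one_sub_smul_onePlusSignMatrix_mul_onePairMatrix (l : R) (a b : Fin n → R) :
    (1 - l • (onePlusSignMatrix R n * onePairMatrix a b)).det = transferProduct l a b 0 0 := by
  obtain ⟨y, hy, hA, -, -⟩ := exists_transferProduct_eq_dotProduct l a b
  set T := onePlusSignMatrix R n
  set K := volterraMatrix a b
  have solves : (1 + l • (T * K)) *ᵥ y = T *ᵥ b := by
    rw [dressedSource, mulVec_sub, mulVec_smul, mulVec_mulVec] at hy
    rw [add_mulVec, one_mulVec, smul_mulVec, sub_eq_iff_eq_add.1 hy]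
  have factors : 1 - l • (T * onePairMatrix a b) =
      (1 + l • (T * K)) * (1 - vecMulVec (l • y) a) := by
    rw [mul_sub, mul_one, smul_vecMulVec, Matrix.mul_smul, mul_vecMulVec, solves,
      onePairMatrix_eq_vecMulVec_sub, mul_sub, mul_vecMulVec, smul_sub]
    abel
  rw [factors, det_mul, det_one_add_smul_onePlusSignMatrix_mul_volterraMatrix, one_mul,
    det_one_sub_vecMulVec, dotProduct_smul, smul_eq_mul, hA]

end Determinant

section IncreasingTuples

open Classical in
/-- The strictly increasing `k`-tuples in `Fin n`, which encode the `k`-element index sets. -/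
def increasingTuples (k n : ℕ) : Finset (Fin k → Fin n) :=
  {f | StrictMono f}

theorem mem_increasingTuples {k n : ℕ} {f : Fin k → Fin n} :
    f ∈ increasingTuples k n ↔ StrictMono f := by
  simp [increasingTuples]

theorem increasingTuples_eq_empty {k n : ℕ} (h : n < k) : increasingTuples k n = ∅ :=
  Finset.eq_empty_of_forall_notMem fun _ hf =>
    h.not_ge (by simpa using Fintype.card_le_of_injective _ (mem_increasingTuples.1 hf).injective)

/-- The tuple `f` followed by `r`; the non-dependent case of `Fin.snoc`. -/
abbrev snocTuple {ι : Type*} {k : ℕ} (f : Fin k → ι) (r : ι) : Fin (k + 1) → ι :=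
  Fin.snoc (α := fun _ => ι) f r

theorem strictMono_snocTuple_last {k n : ℕ} {f : Fin k → Fin n} (hf : StrictMono f) :
    StrictMono (snocTuple (Fin.castSucc ∘ f) (Fin.last n)) := by
  intro i j hij
  induction j using Fin.lastCases with
  | last =>
    obtain ⟨i, rfl⟩ := Fin.exists_castSucc_eq.2 hij.ne
    simp [Fin.castSucc_lt_last]
  | cast j =>
    obtain ⟨i, rfl⟩ := Fin.exists_castSucc_eq.2 (hij.trans (Fin.castSucc_lt_last j)).ne
    simpa using hf (Fin.castSucc_lt_castSucc_iff.1 hij)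

theorem exists_castSucc_comp_eq {k n : ℕ} {f : Fin k → Fin (n + 1)} (hf : StrictMono f)
    (h : ∀ i, f i ≠ Fin.last n) :
    ∃ g ∈ increasingTuples k n, Fin.castSucc ∘ g = f := by
  choose g hg using fun i => Fin.exists_castSucc_eq.2 (h i)
  refine ⟨g, mem_increasingTuples.2 fun i j hij => ?_, funext hg⟩
  rw [← Fin.castSucc_lt_castSucc_iff, hg, hg]
  exact hf hij

theorem increasingTuples_succ_succ (k n : ℕ) :
    increasingTuples (k + 1) (n + 1) =
      (increasingTuples (k + 1) n).image (Fin.castSucc ∘ ·) ∪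
        (increasingTuples k n).image (fun f => snocTuple (Fin.castSucc ∘ f) (Fin.last n)) := by
  ext f
  simp only [Finset.mem_union, Finset.mem_image]
  refine ⟨fun hf => ?_, ?_⟩
  · rw [mem_increasingTuples] at hf
    by_cases hlast : f (Fin.last k) = Fin.last n
    · right
      obtain ⟨g, hg, hgf⟩ := exists_castSucc_comp_eq (f := f ∘ Fin.castSucc)
        (hf.comp Fin.strictMono_castSucc) fun i => (hlast ▸ hf (Fin.castSucc_lt_last i)).ne
      exact ⟨g, hg, by rw [hgf, ← hlast]; exact Fin.snoc_init_self f⟩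
    · left
      exact exists_castSucc_comp_eq hf fun i =>
        ((hf.monotone (Fin.le_last i)).trans_lt (Fin.lt_last_iff_ne_last.2 hlast)).ne
  · rintro (⟨g, hg, rfl⟩ | ⟨g, hg, rfl⟩) <;> rw [mem_increasingTuples] at hg ⊢
    · exact Fin.strictMono_castSucc.comp hg
    · exact strictMono_snocTuple_last hg

theorem sum_increasingTuples_zero {ι M : Type*} [AddCommMonoid M] {n : ℕ} (c : Fin n → ι)
    (φ : (Fin 0 → ι) → M) : ∑ f ∈ increasingTuples 0 n, φ (c ∘ f) = φ Fin.elim0 := by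
  rw [show increasingTuples 0 n = Finset.univ from
    Finset.eq_univ_of_forall fun f => mem_increasingTuples.2 (Subsingleton.strictMono f),
    Fintype.sum_subsingleton _ Fin.elim0]
  exact congrArg φ (Subsingleton.elim _ _)

theorem sum_increasingTuples_succ {ι M : Type*} [AddCommMonoid M] {k n : ℕ}
    (c : Fin n → ι) (z : ι) (φ : (Fin (k + 1) → ι) → M) :
    ∑ f ∈ increasingTuples (k + 1) (n + 1), φ (snocTuple c z ∘ f) =
      ∑ f ∈ increasingTuples (k + 1) n, φ (c ∘ f) +
        ∑ f ∈ increasingTuples k n, φ (snocTuple (c ∘ f) z) := by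
  have castSucc_comp_injective (k : ℕ) :
      Function.Injective fun f : Fin k → Fin n => Fin.castSucc ∘ f :=
    (Fin.castSucc_injective n).comp_left
  have snoc_comp_castSucc (k : ℕ) (f : Fin k → Fin n) :
      snocTuple c z ∘ Fin.castSucc ∘ f = c ∘ f := by
    ext i
    simp
  rw [increasingTuples_succ_succ, Finset.sum_union, Finset.sum_image, Finset.sum_image]
  · simp only [Fin.comp_snoc, Fin.snoc_last, snoc_comp_castSucc]
  · exact fun f _ g _ h => castSucc_comp_injective k (Fin.snoc_injective2 h).1
  · exact (castSucc_comp_injective (k + 1)).injOn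
  · rw [Finset.disjoint_left]
    simp only [Finset.mem_image, not_exists, not_and]
    rintro _ ⟨f, -, rfl⟩ g - h
    exact (Fin.castSucc_lt_last (f (Fin.last k))).ne (by simpa using (congrFun h (Fin.last k)).symm)

theorem sum_orderEmbOfFin_eq_sum_increasingTuples {M : Type*} [AddCommMonoid M] {k n : ℕ}
    (φ : (Fin k → Fin n) → M) :
    ∑ I : {I : Finset (Fin n) // I.card = k}, φ (I.1.orderEmbOfFin I.2) =
      ∑ f ∈ increasingTuples k n, φ f := by
  refine Finset.sum_bij' (fun I _ => I.1.orderEmbOfFin I.2)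
    (fun f hf => ⟨Finset.univ.image f, ?_⟩) (fun I _ => ?_) (fun _ _ => Finset.mem_univ _)
    (fun I _ => ?_) (fun f hf => ?_) (fun _ _ => rfl)
  · rw [Finset.card_image_of_injective _ (mem_increasingTuples.1 hf).injective, Finset.card_fin]
  · exact mem_increasingTuples.2 (I.1.orderEmbOfFin I.2).strictMono
  · simp
  · exact (Finset.orderEmbOfFin_unique _ (fun i => Finset.mem_image_of_mem f (Finset.mem_univ i))
      (mem_increasingTuples.1 hf)).symm

end IncreasingTuples

section Minor

variable {ι R : Type*} [CommRing R]

/-- The minor of `K` with rows `f` and columns `g`, taken in the order in which they are listed. -/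
def minor (K : Matrix ι ι R) {k : ℕ} (f g : Fin k → ι) : R :=
  (K.submatrix f g).det

variable {K : Matrix ι ι R} {k : ℕ} {r p c : ι} {κ : R}

theorem minor_comm (hK : K.IsSymm) (f g : Fin k → ι) : minor K f g = minor K g f := by
  rw [minor, ← det_transpose, transpose_submatrix, hK.eq, minor]

theorem minor_snocTuple_snocTuple {f g : Fin k → ι} (h : ∀ j, K r (g j) = κ * K p (g j)) :
    minor K (snocTuple f r) (snocTuple g c) =
      κ * minor K (snocTuple f p) (snocTuple g c) + (K r c - κ * K p c) * minor K f g := by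
  set M := K.submatrix (snocTuple f p) (snocTuple g c)
  have row_replacement : K.submatrix (snocTuple f r) (snocTuple g c) =
      M.updateRow (Fin.last k)
        (κ • M (Fin.last k) + (K r c - κ * K p c) • Pi.single (Fin.last k) 1) := by
    ext i j
    induction i using Fin.lastCases with
    | cast i => simp [M, (Fin.castSucc_lt_last i).ne]
    | last =>
      induction j using Fin.lastCases with
      | cast j => simp [M, h, (Fin.castSucc_lt_last j).ne]
      | last => simp [M]
  have cofactor : (M.updateRow (Fin.last k) (Pi.single (Fin.last k) 1)).det = minor K f g := by
    rw [← adjugate_apply, adjugate_fin_succ_eq_det_submatrix, Even.neg_one_pow ⟨_, rfl⟩, one_mul,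
      submatrix_submatrix, minor]
    congr 2 <;> ext i <;> simp
  rw [minor, row_replacement, det_updateRow_add, det_updateRow_smul, det_updateRow_smul,
    updateRow_eq_self, cofactor]
  rfl

theorem minor_snocTuple_left {f : Fin k → ι} {g : Fin (k + 1) → ι}
    (h : ∀ j, K r (g j) = κ * K p (g j)) :
    minor K (snocTuple f r) g = κ * minor K (snocTuple f p) g := by
  have hg : snocTuple (g ∘ Fin.castSucc) (g (Fin.last k)) = g := Fin.snoc_init_self g
  rw [← hg, minor_snocTuple_snocTuple (g := g ∘ Fin.castSucc) fun j => h j.castSucc, h, sub_self,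
    zero_mul, add_zero]

theorem minor_snocTuple_snocTuple_self_left {f : Fin k → ι} {g : Fin (k + 2) → ι} :
    minor K (snocTuple (snocTuple f r) r) g = 0 :=
  det_zero_of_row_eq (Fin.castSucc_lt_last (Fin.last k)).ne (by ext j; simp)

theorem minor_snocTuple_snocTuple_swap_left (f : Fin k → ι) (g : Fin (k + 2) → ι) (r s : ι) :
    minor K (snocTuple (snocTuple f r) s) g = -minor K (snocTuple (snocTuple f s) r) g := by
  have swap_last : snocTuple (snocTuple f r) s =
      snocTuple (snocTuple f s) r ∘ Equiv.swap (Fin.last k).castSucc (Fin.last (k + 1)) := by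
    ext i
    induction i using Fin.lastCases with
    | last => simp
    | cast i =>
      induction i using Fin.lastCases with
      | last => simp
      | cast i =>
        have hi := Fin.castSucc_lt_last i
        simp [Equiv.swap_apply_of_ne_of_ne, hi.ne, (Fin.castSucc_lt_last i.castSucc).ne]
  rw [swap_last]
  exact detRowAlternating.map_swap (fun i => K.submatrix (snocTuple (snocTuple f s) r) g i)
    (Fin.castSucc_lt_last _).ne

theorem minor_snocTuple_snocTuple_left_eq_zero {f : Fin k → ι} {g : Fin (k + 2) → ι}
    (h : ∀ j, K r (g j) = κ * K p (g j)) : minor K (snocTuple (snocTuple f r) p) g = 0 := by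
  rw [minor_snocTuple_snocTuple_swap_left, minor_snocTuple_left h,
    minor_snocTuple_snocTuple_self_left, mul_zero, neg_zero]

/-- The sum of the `k × k` minors of `K` along the sequence `c`. -/
def minorSum (K : Matrix ι ι R) (k : ℕ) {n : ℕ} (c : Fin n → ι) : R :=
  ∑ f ∈ increasingTuples k n, ∑ g ∈ increasingTuples k n, minor K (c ∘ f) (c ∘ g)

/-- The sum of the `(k + 1) × (k + 1)` minors of `K` along the sequence `c` whose last row is the
border index `p`. -/
def rowBorderedMinorSum (K : Matrix ι ι R) (p : ι) (k : ℕ) {n : ℕ} (c : Fin n → ι) : R :=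
  ∑ f ∈ increasingTuples k n, ∑ g ∈ increasingTuples (k + 1) n,
    minor K (snocTuple (c ∘ f) p) (c ∘ g)

/-- The sum of the `(k + 1) × (k + 1)` minors of `K` along the sequence `c` whose last row and last
column are the border index `p`. -/
def borderedMinorSum (K : Matrix ι ι R) (p : ι) (k : ℕ) {n : ℕ} (c : Fin n → ι) : R :=
  ∑ f ∈ increasingTuples k n, ∑ g ∈ increasingTuples k n,
    minor K (snocTuple (c ∘ f) p) (snocTuple (c ∘ g) p)

theorem minorSum_zero {n : ℕ} (c : Fin n → ι) : minorSum K 0 c = 1 := by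
  simp [minorSum, minor, sum_increasingTuples_zero c fun _ => (1 : R)]

theorem minorSum_eq_zero {n : ℕ} (h : n < k) (c : Fin n → ι) : minorSum K k c = 0 := by
  rw [minorSum, increasingTuples_eq_empty h, Finset.sum_empty]

theorem rowBorderedMinorSum_eq_zero {n : ℕ} (h : n ≤ k) (c : Fin n → ι) :
    rowBorderedMinorSum K p k c = 0 := by
  simp only [rowBorderedMinorSum, increasingTuples_eq_empty (Nat.lt_succ_of_le h),
    Finset.sum_empty, Finset.sum_const_zero]

theorem borderedMinorSum_eq_zero {n : ℕ} (h : n < k) (c : Fin n → ι) :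
    borderedMinorSum K p k c = 0 := by
  rw [borderedMinorSum, increasingTuples_eq_empty h, Finset.sum_empty]

theorem borderedMinorSum_zero (hp : K p p = 0) {n : ℕ} (c : Fin n → ι) :
    borderedMinorSum K p 0 c = 0 := by
  simp [borderedMinorSum, minor, hp, Fin.snoc]

theorem rowBorderedMinorSum_eq_sum_col (hK : K.IsSymm) {n : ℕ} (c : Fin n → ι) :
    rowBorderedMinorSum K p k c =
      ∑ f ∈ increasingTuples (k + 1) n, ∑ g ∈ increasingTuples k n,
        minor K (c ∘ f) (snocTuple (c ∘ g) p) := by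
  rw [rowBorderedMinorSum, Finset.sum_comm]
  simp only [minor_comm hK (snocTuple _ _)]

end Minor

section MinorRecursion

variable {ι R : Type*} [CommRing R] {K : Matrix ι ι R} {p z : ι} {κ : R}

theorem minor_snocTuple_border (hK : K.IsSymm) (hp : K p p = 0) {k : ℕ} {f g : Fin k → ι}
    (h : ∀ j, K z (f j) = κ * K p (f j)) :
    minor K (snocTuple f p) (snocTuple g z) =
      κ * minor K (snocTuple f p) (snocTuple g p) + K p z * minor K f g := by
  rw [minor_comm hK, minor_snocTuple_snocTuple h, hp, mul_zero, sub_zero, hK.apply p z,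
    minor_comm hK g, minor_comm hK (snocTuple g p)]

theorem minor_snocTuple_snocTuple_border (hK : K.IsSymm) (hp : K p p = 0) {k : ℕ}
    {f : Fin k → ι} {g : Fin (k + 1) → ι} (h : ∀ j, K z (g j) = κ * K p (g j)) :
    minor K (snocTuple (snocTuple f z) p) (snocTuple g p) = -K p z * minor K (snocTuple f p) g := by
  rw [minor_snocTuple_snocTuple_swap_left, minor_snocTuple_snocTuple h,
    minor_snocTuple_snocTuple_self_left, hp, hK.apply p z]
  ring

variable {n : ℕ} {c : Fin n → ι} (hK : K.IsSymm) (hp : K p p = 0)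
  (hc : ∀ i, K z (c i) = κ * K p (c i)) (hz : K z z = κ * K p z)

include hK hp hc hz

theorem minorSum_snocTuple (k : ℕ) :
    minorSum K (k + 1) (snocTuple c z) =
      minorSum K (k + 1) c + 2 * κ * rowBorderedMinorSum K p k c +
        κ ^ 2 * borderedMinorSum K p k c + κ * K p z * minorSum K k c := by
  have row (f : Fin k → Fin n) (g : Fin (k + 1) → Fin n) :
      minor K (snocTuple (c ∘ f) z) (c ∘ g) = κ * minor K (snocTuple (c ∘ f) p) (c ∘ g) :=
    minor_snocTuple_left fun j => hc (g j)
  have col (f : Fin (k + 1) → Fin n) (g : Fin k → Fin n) :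
      minor K (c ∘ f) (snocTuple (c ∘ g) z) = κ * minor K (c ∘ f) (snocTuple (c ∘ g) p) := by
    rw [minor_comm hK, row, minor_comm hK]
  have corner (f g : Fin k → Fin n) :
      minor K (snocTuple (c ∘ f) z) (snocTuple (c ∘ g) z) =
        κ ^ 2 * minor K (snocTuple (c ∘ f) p) (snocTuple (c ∘ g) p) +
          κ * K p z * minor K (c ∘ f) (c ∘ g) := by
    rw [minor_snocTuple_snocTuple (g := c ∘ g) fun j => hc (g j),
      minor_snocTuple_border (f := c ∘ f) hK hp fun j => hc (f j), hz]
    ring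
  rw [minorSum, sum_increasingTuples_succ c z fun f =>
    ∑ g ∈ increasingTuples (k + 1) (n + 1), minor K f (snocTuple c z ∘ g)]
  simp only [sum_increasingTuples_succ c z (minor K _), Finset.sum_add_distrib, row, col, corner,
    ← Finset.mul_sum, ← rowBorderedMinorSum_eq_sum_col hK]
  simp only [minorSum, rowBorderedMinorSum, borderedMinorSum]
  ring

theorem rowBorderedMinorSum_snocTuple (k : ℕ) :
    rowBorderedMinorSum K p k (snocTuple c z) =
      rowBorderedMinorSum K p k c + κ * borderedMinorSum K p k c + K p z * minorSum K k c := by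
  have border (f g : Fin k → Fin n) :
      minor K (snocTuple (c ∘ f) p) (snocTuple (c ∘ g) z) =
        κ * minor K (snocTuple (c ∘ f) p) (snocTuple (c ∘ g) p) +
          K p z * minor K (c ∘ f) (c ∘ g) :=
    minor_snocTuple_border hK hp fun j => hc (f j)
  have hcz : ∀ i, K z (snocTuple c z i) = κ * K p (snocTuple c z i) :=
    Fin.lastCases (by simpa using hz) (by simpa using hc)
  have rows_avoid_last : rowBorderedMinorSum K p k (snocTuple c z) =
      ∑ f ∈ increasingTuples k n, ∑ g ∈ increasingTuples (k + 1) (n + 1),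
        minor K (snocTuple (c ∘ f) p) (snocTuple c z ∘ g) := by
    let rowSum (f : Fin k → ι) : R :=
      ∑ g ∈ increasingTuples (k + 1) (n + 1), minor K (snocTuple f p) (snocTuple c z ∘ g)
    change ∑ f ∈ increasingTuples k (n + 1), rowSum (snocTuple c z ∘ f) =
      ∑ f ∈ increasingTuples k n, rowSum (c ∘ f)
    cases k with
    | zero => rw [sum_increasingTuples_zero, sum_increasingTuples_zero]
    | succ k =>
      rw [sum_increasingTuples_succ, add_eq_left]
      exact Finset.sum_eq_zero fun f _ => Finset.sum_eq_zero fun g _ =>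
        minor_snocTuple_snocTuple_left_eq_zero fun j => hcz (g j)
  rw [rows_avoid_last]
  simp only [sum_increasingTuples_succ c z (minor K _), Finset.sum_add_distrib, border,
    ← Finset.mul_sum]
  rw [rowBorderedMinorSum, borderedMinorSum, minorSum, add_assoc]

theorem borderedMinorSum_snocTuple (k : ℕ) :
    borderedMinorSum K p (k + 1) (snocTuple c z) =
      borderedMinorSum K p (k + 1) c - 2 * K p z * rowBorderedMinorSum K p k c -
        κ * K p z * borderedMinorSum K p k c - K p z ^ 2 * minorSum K k c := by
  have row (f : Fin k → Fin n) (g : Fin (k + 1) → Fin n) :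
      minor K (snocTuple (snocTuple (c ∘ f) z) p) (snocTuple (c ∘ g) p) =
        -K p z * minor K (snocTuple (c ∘ f) p) (c ∘ g) :=
    minor_snocTuple_snocTuple_border hK hp fun j => hc (g j)
  have col (f : Fin (k + 1) → Fin n) (g : Fin k → Fin n) :
      minor K (snocTuple (c ∘ f) p) (snocTuple (snocTuple (c ∘ g) z) p) =
        -K p z * minor K (c ∘ f) (snocTuple (c ∘ g) p) := by
    rw [minor_comm hK, row, minor_comm hK]
  have corner (f g : Fin k → Fin n) :
      minor K (snocTuple (snocTuple (c ∘ f) z) p) (snocTuple (snocTuple (c ∘ g) z) p) =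
        -(κ * K p z) * minor K (snocTuple (c ∘ f) p) (snocTuple (c ∘ g) p) +
          -K p z ^ 2 * minor K (c ∘ f) (c ∘ g) := by
    rw [minor_snocTuple_snocTuple_border (κ := κ) hK hp
        (Fin.lastCases (by simpa using hz) fun j => by simpa using hc (g j)),
      minor_snocTuple_border (f := c ∘ f) hK hp fun j => hc (f j)]
    ring
  have split_cols (f : Fin (k + 2) → ι) :=
    sum_increasingTuples_succ (k := k) c z fun g => minor K f (snocTuple g p)
  rw [borderedMinorSum, sum_increasingTuples_succ c z fun f =>
    ∑ g ∈ increasingTuples (k + 1) (n + 1),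
      minor K (snocTuple f p) (snocTuple (snocTuple c z ∘ g) p)]
  simp only [split_cols, Finset.sum_add_distrib, row, col, corner, ← Finset.mul_sum,
    ← rowBorderedMinorSum_eq_sum_col hK]
  simp only [minorSum, rowBorderedMinorSum, borderedMinorSum]
  ring

end MinorRecursion

section GeneratingFunction

variable {ι R : Type*} [CommRing R] {K : Matrix ι ι R} {p : ι} {n : ℕ}

/-- The polynomials `A`, `B` and `L` are the generating functions of the minors of `K` along the
sequence `c`: without border, with a border row `p`, and with both a border row and column `p`. -/
structure GenerateMinorSums (K : Matrix ι ι R) (p : ι) (c : Fin n → ι) (A B L : R[X]) : Prop where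
  coeff_plain : ∀ k, A.coeff k = minorSum K k c
  coeff_rowBordered : ∀ k, B.coeff k = rowBorderedMinorSum K p k c
  coeff_bordered : ∀ k, L.coeff k = borderedMinorSum K p k c

theorem generateMinorSums_nil (hp : K p p = 0) (c : Fin 0 → ι) :
    GenerateMinorSums K p c 1 0 0 := by
  refine ⟨?_, fun k => ?_, ?_⟩
  · rintro (_ | k)
    · rw [coeff_one_zero, minorSum_zero]
    · rw [coeff_one, if_neg k.succ_ne_zero, minorSum_eq_zero k.succ_pos]
  · rw [coeff_zero, rowBorderedMinorSum_eq_zero k.zero_le]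
  · rintro (_ | k)
    · rw [coeff_zero, borderedMinorSum_zero hp]
    · rw [coeff_zero, borderedMinorSum_eq_zero k.succ_pos]

theorem GenerateMinorSums.snocTuple {c : Fin n → ι} {z : ι} {κ : R} {A B L : R[X]}
    (h : GenerateMinorSums K p c A B L) (hK : K.IsSymm) (hp : K p p = 0)
    (hc : ∀ i, K z (c i) = κ * K p (c i)) (hz : K z z = κ * K p z) :
    GenerateMinorSums K p (snocTuple c z)
      (A + X * (C (2 * κ) * B + C (κ ^ 2) * L + C (κ * K p z) * A))
      (B + C κ * L + C (K p z) * A)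
      (L - X * (C (2 * K p z) * B + C (κ * K p z) * L + C (K p z ^ 2) * A)) := by
  obtain ⟨hA, hB, hL⟩ := h
  refine ⟨?_, fun k => ?_, ?_⟩
  · rintro (_ | k)
    · simp [hA, minorSum_zero]
    · simp only [minorSum_snocTuple hK hp hc hz, coeff_add, coeff_X_mul, coeff_C_mul, hA, hB, hL]
      ring
  · simp only [rowBorderedMinorSum_snocTuple hK hp hc hz, coeff_add, coeff_C_mul, hA, hB, hL]
  · rintro (_ | k)
    · simp [hL, borderedMinorSum_zero hp]
    · simp only [borderedMinorSum_snocTuple hK hp hc hz, coeff_sub, coeff_add, coeff_X_mul,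
        coeff_C_mul, hA, hB, hL]
      ring

theorem generateMinorSums_transferProduct (hK : K.IsSymm) (hp : K p p = 0) {a : Fin n → R}
    {c : Fin n → ι} (hc : ∀ i j, j ≤ i → K (c i) (c j) = a i * K p (c j)) :
    GenerateMinorSums K p c (transferProduct (-X) (C ∘ a) (C ∘ K p ∘ c) 0 0)
      (transferProduct (-X) (C ∘ a) (C ∘ K p ∘ c) 1 0)
      (-X * transferProduct (-X) (C ∘ a) (C ∘ K p ∘ c) 2 0) := by
  induction n with
  | zero => simpa using generateMinorSums_nil hp c
  | succ n ih =>
    have leading := ih (a := a ∘ Fin.castSucc) (c := c ∘ Fin.castSucc)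
      fun i j hij => hc _ _ (Fin.castSucc_le_castSucc_iff.2 hij)
    have extended := leading.snocTuple hK hp (fun i => hc _ i.castSucc (Fin.le_last _))
      (hc (Fin.last n) (Fin.last n) le_rfl)
    convert extended using 1
    · exact (Fin.snoc_init_self c).symm
    · rw [transferProduct_succ_zero_zero]
      simp only [Function.comp_apply, Function.comp_assoc, C_mul, C_pow, C_ofNat]
      ring
    · rw [transferProduct_succ_one_zero]
      simp only [Function.comp_apply, Function.comp_assoc]
      ring
    · rw [transferProduct_succ_two_zero]
      simp only [Function.comp_apply, Function.comp_assoc, C_mul, C_pow, C_ofNat]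
      ring

/-- The one-pair matrix with border row and column `b`, and corner `0`, indexed by `inr ()`. -/
def borderedOnePairMatrix (a b : Fin n → R) : Matrix (Fin n ⊕ Unit) (Fin n ⊕ Unit) R :=
  fromBlocks (onePairMatrix a b) (replicateCol Unit b) (replicateRow Unit b) 0

theorem isSymm_borderedOnePairMatrix (a b : Fin n → R) : (borderedOnePairMatrix a b).IsSymm :=
  (isSymm_onePairMatrix a b).fromBlocks rfl isSymm_zero

theorem coeff_transferProduct_neg_X (a b : Fin n → R) (k : ℕ) :
    (transferProduct (-X) (C ∘ a) (C ∘ b) 0 0).coeff k = minorSum (onePairMatrix a b) k id := by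
  have hK := isSymm_borderedOnePairMatrix a b
  have generating := generateMinorSums_transferProduct (p := Sum.inr ()) (c := Sum.inl) hK rfl
    fun _ _ h => onePairMatrix_apply_of_le a b h
  exact generating.coeff_plain k

theorem coeff_transferProduct_X (a b : Fin n → R) (k : ℕ) :
    (transferProduct X (C ∘ a) (C ∘ b) 0 0).coeff k =
      (-1) ^ k * minorSum (onePairMatrix a b) k id := by
  have reflect : (transferProduct (-X) (C ∘ a) (C ∘ b) 0 0).comp (C (-1) * X) =
      transferProduct X (C ∘ a) (C ∘ b) 0 0 := by
    have h := map_transferProduct (compRingHom (C (-1) * X)) (-X) (C ∘ a) (C ∘ b)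
    simpa [Function.comp_def] using congrFun₂ h 0 0
  rw [← reflect, comp_C_mul_X_coeff, coeff_transferProduct_neg_X, mul_comm]

end GeneratingFunction

section Peakon

variable {n : ℕ}

theorem jumpMatrix_eq_transferMatrix (ξ μ : ℝ) :
    jumpMatrix ξ μ = transferMatrix X (C (μ * Real.exp (-ξ))) (C (μ * Real.exp ξ)) := by
  have exp_mul_exp_neg : Real.exp ξ * Real.exp (-ξ) = 1 := by rw [← Real.exp_add]; simp
  have exp_two_mul (η : ℝ) : Real.exp (2 * η) = Real.exp η ^ 2 := by rw [two_mul, Real.exp_add, sq]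
  have hXab : X * C (μ * Real.exp (-ξ)) * C (μ * Real.exp ξ) = C (μ ^ 2) * X := by
    rw [mul_assoc, ← C_mul, X_mul_C]
    congr 2
    linear_combination μ ^ 2 * exp_mul_exp_neg
  have hexp : Real.exp (-2 * ξ) = Real.exp (-ξ) ^ 2 := by rw [← exp_two_mul]; ring_nf
  rw [jumpMatrix, transferMatrix, hXab, exp_two_mul, hexp]
  ext i j : 1
  fin_cases i <;> fin_cases j <;>
    simp only [of_apply, cons_val, Fin.zero_eta, Fin.mk_one, Fin.reduceFinMk, C_mul, C_pow,
      C_ofNat] <;> ring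

theorem totalJumpMatrix_eq_transferProduct (x m : Fin n → ℝ) :
    totalJumpMatrix x m = transferProduct X (C ∘ fun k => m k * Real.exp (-x k))
      (C ∘ fun k => m k * Real.exp (x k)) := by
  simp only [totalJumpMatrix, transferProduct, jumpMatrix_eq_transferMatrix, Function.comp_apply]

theorem matP_mul_matE_mul_matP_apply (x m : Fin n → ℝ) (i j : Fin n) :
    (matP m * matE x * matP m) i j = m i * m j * Real.exp (-|x i - x j|) := by
  rw [matP, matE, mul_diagonal, diagonal_mul, of_apply]
  ring

theorem matP_mul_matE_mul_matP_eq_onePairMatrix {x : Fin n → ℝ} (m : Fin n → ℝ)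
    (hx : Monotone x) :
    matP m * matE x * matP m =
      onePairMatrix (fun k => m k * Real.exp (-x k)) fun k => m k * Real.exp (x k) := by
  have lower (i j : Fin n) (h : j ≤ i) :
      m i * m j * Real.exp (-|x i - x j|) = m i * Real.exp (-x i) * (m j * Real.exp (x j)) := by
    rw [abs_of_nonneg (sub_nonneg.2 (hx h)), neg_sub, sub_eq_neg_add, Real.exp_add]
    ring
  ext i j
  rw [matP_mul_matE_mul_matP_apply]
  rcases le_total j i with h | h
  · rw [onePairMatrix_apply_of_le _ _ h, lower i j h]
  · rw [(isSymm_onePairMatrix _ _).apply, onePairMatrix_apply_of_le _ _ h, ← lower j i h,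
      abs_sub_comm, mul_comm (m i)]

theorem map_matT {S : Type*} [CommRing S] (φ : ℝ →+* S) :
    (matT n).map φ = onePlusSignMatrix S n := by
  ext i j
  rw [map_apply, matT, onePlusSignMatrix, of_apply, of_apply]
  rcases lt_trichotomy i j with h | rfl | h
  · rw [Real.sign_of_neg (by simpa using h)]
    simp [h.not_gt, h.ne]
  · simp
  · rw [Real.sign_of_pos (by simpa using h), one_add_one_eq_two, map_ofNat, if_pos h]

theorem map_onePairMatrix {R S : Type*} [CommRing R] [CommRing S] (φ : R →+* S) (a b : Fin n → R) :
    (onePairMatrix a b).map φ = onePairMatrix (φ ∘ a) (φ ∘ b) := by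
  ext i j
  simp [onePairMatrix]

theorem polyA_eq_det {x : Fin n → ℝ} (m : Fin n → ℝ) (hx : Monotone x) :
    polyA x m = (1 - (X : ℝ[X]) • (matT n * matP m * matE x * matP m).map C).det := by
  have factor : matT n * matP m * matE x * matP m = matT n * (matP m * matE x * matP m) := by
    simp only [mul_assoc]
  rw [factor, matP_mul_matE_mul_matP_eq_onePairMatrix m hx, Matrix.map_mul, map_matT,
    map_onePairMatrix, det_one_sub_smul_onePlusSignMatrix_mul_onePairMatrix, polyA,
    totalJumpMatrix_eq_transferProduct]

theorem H_eq_minorSum (k : ℕ) (x m : Fin n → ℝ) :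
    H k x m = minorSum
      (onePairMatrix (fun i => m i * Real.exp (-x i)) fun i => m i * Real.exp (x i)) k id := by
  rw [H, polyA, totalJumpMatrix_eq_transferProduct, coeff_transferProduct_X, ← mul_assoc,
    ← mul_pow, neg_one_mul, neg_neg, one_pow, one_mul]

theorem H_zero (x m : Fin n → ℝ) : H 0 x m = 1 := by
  rw [H_eq_minorSum, minorSum_zero]

theorem H_eq_zero {k : ℕ} (h : n < k) (x m : Fin n → ℝ) : H k x m = 0 := by
  rw [H_eq_minorSum, minorSum_eq_zero h]

theorem coeff_polyA (x m : Fin n → ℝ) (k : ℕ) : (polyA x m).coeff k = (-1) ^ k * H k x m := by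
  rw [H, ← mul_assoc, ← mul_pow, neg_one_mul, neg_neg, one_pow, one_mul]

theorem polyA_eq_sum_H (x m : Fin n → ℝ) :
    polyA x m = ∑ k ∈ Finset.range (n + 1), C (H k x m) * (-X) ^ k := by
  have degree_lt : (polyA x m).natDegree < n + 1 :=
    Nat.lt_succ_of_le <| natDegree_le_iff_coeff_eq_zero.2 fun k hk => by
      rw [coeff_polyA, H_eq_zero hk, mul_zero]
  conv_lhs => rw [as_sum_range_C_mul_X_pow' _ degree_lt]
  refine Finset.sum_congr rfl fun k _ => ?_
  rw [coeff_polyA, neg_pow (X : ℝ[X]), C_mul, C_pow, C_neg, C_1]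
  ring

theorem sumMinors_eq_minorSum (k : ℕ) (K : Matrix (Fin n) (Fin n) ℝ) :
    sumMinors k K = minorSum K k id := by
  rw [sumMinors, minorSum, ← sum_orderEmbOfFin_eq_sum_increasingTuples]
  simp only [← sum_orderEmbOfFin_eq_sum_increasingTuples]
  rfl

theorem H_eq_sumMinors {x : Fin n → ℝ} (m : Fin n → ℝ) (hx : Monotone x) (k : ℕ) :
    H k x m = sumMinors k (matP m * matE x * matP m) := by
  rw [H_eq_minorSum, matP_mul_matE_mul_matP_eq_onePairMatrix m hx, sumMinors_eq_minorSum]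

end Peakon

section ZeroCurvature

open scoped Matrix.Norms.Operator

theorem hasDerivWithinAt_prod_reverse_ofFn {𝕜 𝔸 : Type*} [NontriviallyNormedField 𝕜]
    [NormedRing 𝔸] [NormedAlgebra 𝕜 𝔸] {J : Set 𝕜} {t : 𝕜} {n : ℕ} {S : 𝕜 → Fin n → 𝔸}
    (V : Fin (n + 1) → 𝔸)
    (hS : ∀ k, HasDerivWithinAt (S · k) (V k.succ * S t k - S t k * V k.castSucc) J t) :
    HasDerivWithinAt (fun s => (List.ofFn (S s)).reverse.prod)
      (V (Fin.last n) * (List.ofFn (S t)).reverse.prod -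
        (List.ofFn (S t)).reverse.prod * V 0) J t := by
  induction n with
  | zero => simpa using hasDerivWithinAt_const t J (1 : 𝔸)
  | succ n ih =>
    have leading :=
      ih (S := fun s k => S s k.castSucc) (fun k => V k.castSucc) fun k => hS k.castSucc
    simp only [List.ofFn_succ', List.concat_eq_append, List.reverse_append,
      List.reverse_singleton, List.singleton_append, List.prod_cons]
    refine ((hS (Fin.last n)).mul leading).congr_deriv ?_
    rw [Fin.succ_last, Fin.castSucc_zero]
    noncomm_ring

theorem hasDerivWithinAt_matrix {m n : Type*} [Finite m] [Finite n] {S : ℝ → Matrix m n ℝ}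
    {S' : Matrix m n ℝ} {J : Set ℝ} {t : ℝ} :
    HasDerivWithinAt S S' J t ↔
      ∀ i j, HasDerivWithinAt (fun s => S s i j) (S' i j) J t := by
  have := Fintype.ofFinite m
  have := Fintype.ofFinite n
  exact hasDerivWithinAt_pi.trans (forall_congr' fun _ => hasDerivWithinAt_pi)

/-- The time part of the Lax pair at a point `ξ` of a gap between two peakons, where the wave is
`α e^ξ + β e^{-ξ}`. -/
noncomputable def laxMatrix (l α β : ℝ) : Matrix (Fin 3) (Fin 3) ℝ :=
  !![-2 * α * β, 2 * α, 2 * l * α ^ 2;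
     -l⁻¹ * β, l⁻¹, α;
     -2 * l⁻¹ * β ^ 2, 2 * l⁻¹ * β, 2 * α * β]

theorem hasDerivWithinAt_transferMatrix {a b : ℝ → ℝ} {a' b' t : ℝ} {J : Set ℝ} (l : ℝ)
    (ha : HasDerivWithinAt a a' J t) (hb : HasDerivWithinAt b b' J t) :
    HasDerivWithinAt (fun s => transferMatrix l (a s) (b s))
      !![-l * (a' * b t + a t * b'), -2 * l * a', -l ^ 2 * (2 * a t * a');
         b', 0, l * a';
         2 * b t * b', 2 * b', l * (a' * b t + a t * b')] J t := by
  rw [hasDerivWithinAt_matrix]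
  intro i j
  fin_cases i <;> fin_cases j <;>
    simp only [transferMatrix, of_apply, cons_val, Fin.zero_eta, Fin.mk_one, Fin.reduceFinMk]
  · exact (((ha.const_mul l).fun_mul hb).const_sub 1).congr_deriv (by ring)
  · exact ha.const_mul (-2 * l)
  · exact ((ha.fun_pow 2).const_mul (-l ^ 2)).congr_deriv (by ring)
  · exact hb
  · exact hasDerivWithinAt_const t J 1
  · exact ha.const_mul l
  · exact (hb.fun_pow 2).congr_deriv (by ring)
  · exact hb.const_mul 2
  · exact (((ha.const_mul l).fun_mul hb).const_add 1).congr_deriv (by ring)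

theorem laxMatrix_mul_transferMatrix_sub {l : ℝ} (hl : l ≠ 0) {a b a' b' α β : ℝ}
    (ha' : a' = -(a * β + a * b + b * α) * (2 * α + a))
    (hb' : b' = (a * β + a * b + b * α) * (2 * β + b)) :
    laxMatrix l α (β + b) * transferMatrix l a b - transferMatrix l a b * laxMatrix l (α + a) β =
      !![-l * (a' * b + a * b'), -2 * l * a', -l ^ 2 * (2 * a * a');
         b', 0, l * a';
         2 * b * b', 2 * b', l * (a' * b + a * b')] := by
  subst ha' hb'
  ext i j
  fin_cases i <;> fin_cases j <;>
    simp only [laxMatrix, transferMatrix, Matrix.sub_apply, mul_apply, Fin.sum_univ_three,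
      of_apply, cons_val, Fin.zero_eta, Fin.mk_one, Fin.reduceFinMk] <;> field_simp <;> ring

variable {n : ℕ}

/-- The matrix `laxMatrix` in the `j`-th gap from the left, where the peakons `i ≥ j` on the right
contribute their `a i` to the coefficient of `e^ξ`, and those on the left their `b i` to the
coefficient of `e^{-ξ}`. -/
noncomputable def gapLaxMatrix (l : ℝ) (a b : Fin n → ℝ) (j : Fin (n + 1)) :
    Matrix (Fin 3) (Fin 3) ℝ :=
  laxMatrix l (∑ i with j ≤ i.castSucc, a i) (∑ i with i.castSucc < j, b i)

theorem gapLaxMatrix_castSucc (l : ℝ) (a b : Fin n → ℝ) (k : Fin n) :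
    gapLaxMatrix l a b k.castSucc =
      laxMatrix l (∑ i ∈ Finset.Ioi k, a i + a k) (∑ i ∈ Finset.Iio k, b i) := by
  simp only [gapLaxMatrix, Fin.castSucc_le_castSucc_iff, Fin.castSucc_lt_castSucc_iff,
    Finset.filter_le_eq_Ici, Finset.filter_gt_eq_Iio, Finset.sum_Ioi_add_eq_sum_Ici]

theorem gapLaxMatrix_succ (l : ℝ) (a b : Fin n → ℝ) (k : Fin n) :
    gapLaxMatrix l a b k.succ =
      laxMatrix l (∑ i ∈ Finset.Ioi k, a i) (∑ i ∈ Finset.Iio k, b i + b k) := by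
  simp only [gapLaxMatrix, Fin.succ_le_castSucc_iff, Fin.castSucc_lt_succ_iff,
    Finset.filter_lt_eq_Ioi, Finset.filter_ge_eq_Iic, Finset.sum_Iio_add_eq_sum_Iic]

theorem gapLaxMatrix_last_zero_apply (l : ℝ) (a b : Fin n → ℝ) (j : Fin 3) :
    gapLaxMatrix l a b (Fin.last n) 0 j = 0 := by
  fin_cases j <;> simp [gapLaxMatrix, laxMatrix, (Fin.castSucc_lt_last _).not_ge]

theorem gapLaxMatrix_zero_apply_zero (l : ℝ) (a b : Fin n → ℝ) (i : Fin 3) :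
    gapLaxMatrix l a b 0 i 0 = 0 := by
  fin_cases i <;> simp [gapLaxMatrix, laxMatrix]

theorem hasDerivWithinAt_transferProduct {a b : ℝ → Fin n → ℝ} {l t : ℝ} {J : Set ℝ}
    {p : Fin n → ℝ} (hl : l ≠ 0)
    (hp : ∀ k, p k = a t k * ∑ i ∈ Finset.Iio k, b t i + a t k * b t k +
      b t k * ∑ i ∈ Finset.Ioi k, a t i)
    (ha : ∀ k, HasDerivWithinAt (a · k) (-p k * (2 * ∑ i ∈ Finset.Ioi k, a t i + a t k)) J t)
    (hb : ∀ k, HasDerivWithinAt (b · k) (p k * (2 * ∑ i ∈ Finset.Iio k, b t i + b t k)) J t) :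
    HasDerivWithinAt (fun s => transferProduct l (a s) (b s))
      (gapLaxMatrix l (a t) (b t) (Fin.last n) * transferProduct l (a t) (b t) -
        transferProduct l (a t) (b t) * gapLaxMatrix l (a t) (b t) 0) J t := by
  refine hasDerivWithinAt_prod_reverse_ofFn _ fun k => ?_
  rw [gapLaxMatrix_succ, gapLaxMatrix_castSucc,
    laxMatrix_mul_transferMatrix_sub hl (by rw [← hp]) (by rw [← hp])]
  exact hasDerivWithinAt_transferMatrix l (ha k) (hb k)

theorem hasDerivWithinAt_transferProduct_zero_zero {a b : ℝ → Fin n → ℝ} {l t : ℝ} {J : Set ℝ}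
    {p : Fin n → ℝ} (hl : l ≠ 0)
    (hp : ∀ k, p k = a t k * ∑ i ∈ Finset.Iio k, b t i + a t k * b t k +
      b t k * ∑ i ∈ Finset.Ioi k, a t i)
    (ha : ∀ k, HasDerivWithinAt (a · k) (-p k * (2 * ∑ i ∈ Finset.Ioi k, a t i + a t k)) J t)
    (hb : ∀ k, HasDerivWithinAt (b · k) (p k * (2 * ∑ i ∈ Finset.Iio k, b t i + b t k)) J t) :
    HasDerivWithinAt (fun s => transferProduct l (a s) (b s) 0 0) 0 J t := by
  have hd := hasDerivWithinAt_transferProduct hl hp ha hb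
  refine (hasDerivWithinAt_matrix.1 hd 0 0).congr_deriv ?_
  rw [Matrix.sub_apply, mul_apply, mul_apply]
  simp only [gapLaxMatrix_last_zero_apply, gapLaxMatrix_zero_apply_zero, zero_mul, mul_zero,
    Finset.sum_const_zero, sub_zero]

end ZeroCurvature

section ConstantOfMotion

variable {n : ℕ}

theorem sum_eq_sum_Iio_add_add_sum_Ioi {M : Type*} [AddCommMonoid M] (f : Fin n → M) (k : Fin n) :
    ∑ i, f i = ∑ i ∈ Finset.Iio k, f i + f k + ∑ i ∈ Finset.Ioi k, f i := by
  rw [Finset.sum_Iio_add_eq_sum_Iic, ← Finset.filter_ge_eq_Iic, ← Finset.filter_lt_eq_Ioi]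
  simp only [← not_le, Finset.sum_filter_add_sum_filter_not]

theorem exp_neg_abs_sub_of_le {ξ η : ℝ} (h : η ≤ ξ) :
    Real.exp (-|ξ - η|) = Real.exp η * Real.exp (-ξ) := by
  rw [abs_of_nonneg (sub_nonneg.2 h), ← Real.exp_add, neg_sub, sub_eq_add_neg]

theorem exp_neg_abs_sub_of_ge {ξ η : ℝ} (h : ξ ≤ η) :
    Real.exp (-|ξ - η|) = Real.exp (-η) * Real.exp ξ := by
  rw [abs_sub_comm, exp_neg_abs_sub_of_le h, mul_comm]

variable {x : Fin n → ℝ} (m : Fin n → ℝ) (k : Fin n)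

theorem wave_apply_position (hx : Monotone x) :
    wave x m (x k) =
      (∑ i ∈ Finset.Iio k, m i * Real.exp (x i)) * Real.exp (-x k) + m k +
        (∑ i ∈ Finset.Ioi k, m i * Real.exp (-x i)) * Real.exp (x k) := by
  rw [wave, sum_eq_sum_Iio_add_add_sum_Ioi _ k, Finset.sum_mul, Finset.sum_mul, sub_self,
    abs_zero, neg_zero, Real.exp_zero, mul_one]
  congr 1
  · congr 1
    refine Finset.sum_congr rfl fun i hi => ?_
    rw [exp_neg_abs_sub_of_le (hx (Finset.mem_Iio.1 hi).le), mul_assoc]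
  · refine Finset.sum_congr rfl fun i hi => ?_
    rw [exp_neg_abs_sub_of_ge (hx (Finset.mem_Ioi.1 hi).le), mul_assoc]

theorem waveSlopeAvg_apply_position (hx : StrictMono x) :
    waveSlopeAvg x m (x k) =
      -((∑ i ∈ Finset.Iio k, m i * Real.exp (x i)) * Real.exp (-x k)) +
        (∑ i ∈ Finset.Ioi k, m i * Real.exp (-x i)) * Real.exp (x k) := by
  rw [waveSlopeAvg, sum_eq_sum_Iio_add_add_sum_Ioi _ k, Finset.sum_mul, Finset.sum_mul, sub_self,
    Real.sign_zero, mul_zero, zero_mul, add_zero, neg_add, ← Finset.sum_neg_distrib (s := .Ioi k)]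
  congr 1
  · congr 1
    refine Finset.sum_congr rfl fun i hi => ?_
    have hlt := hx (Finset.mem_Iio.1 hi)
    rw [Real.sign_of_pos (sub_pos.2 hlt), exp_neg_abs_sub_of_le hlt.le, mul_one, mul_assoc]
  · refine Finset.sum_congr rfl fun i hi => ?_
    have hlt := hx (Finset.mem_Ioi.1 hi)
    rw [Real.sign_of_neg (sub_neg.2 hlt), exp_neg_abs_sub_of_ge hlt.le]
    ring

theorem eval_polyA (l : ℝ) (x m : Fin n → ℝ) :
    (polyA x m).eval l = transferProduct l (fun k => m k * Real.exp (-x k))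
      (fun k => m k * Real.exp (x k)) 0 0 := by
  have h := map_transferProduct (evalRingHom l) X (C ∘ fun k => m k * Real.exp (-x k))
    (C ∘ fun k => m k * Real.exp (x k))
  rw [← totalJumpMatrix_eq_transferProduct] at h
  simpa [polyA, Function.comp_def] using congrFun₂ h 0 0

theorem IsSolutionOn.hasDerivWithinAt_eval_polyA {x m : ℝ → Fin n → ℝ} {J : Set ℝ}
    (h : IsSolutionOn x m J) {t : ℝ} (ht : t ∈ J) {l : ℝ} (hl : l ≠ 0) :
    HasDerivWithinAt (fun s => (polyA (x s) (m s)).eval l) 0 J t := by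
  have hx := h.ordered t ht
  have wave_eq (k) := wave_apply_position (m t) k hx.monotone
  have slope_eq (k) := waveSlopeAvg_apply_position (m t) k hx
  have exp_mul_exp_neg (k) : Real.exp (x t k) * Real.exp (-x t k) = 1 := by
    rw [← Real.exp_add, add_neg_cancel, Real.exp_zero]
  simp only [eval_polyA]
  set u := fun k => wave (x t) (m t) (x t k)
  refine hasDerivWithinAt_transferProduct_zero_zero (p := fun k => m t k * u k)
    hl (fun k => ?_) (fun k => ?_) fun k => ?_
  · linear_combination m t k * wave_eq k - m t k ^ 2 * exp_mul_exp_neg k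
  · refine ((h.momentum t ht k).mul (h.position t ht k).neg.exp).congr_deriv ?_
    linear_combination -m t k * u k * Real.exp (-x t k) * (wave_eq k + slope_eq k) -
      2 * m t k * u k * (∑ i ∈ Finset.Ioi k, m t i * Real.exp (-x t i)) * exp_mul_exp_neg k
  · refine ((h.momentum t ht k).mul (h.position t ht k).exp).congr_deriv ?_
    linear_combination m t k * u k * Real.exp (x t k) * (wave_eq k - slope_eq k) +
      2 * m t k * u k * (∑ i ∈ Finset.Iio k, m t i * Real.exp (x t i)) * exp_mul_exp_neg k

theorem isConstantOfMotion_eval_polyA {l : ℝ} (hl : l ≠ 0) :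
    IsConstantOfMotion (n := n) fun x m => (polyA x m).eval l := by
  intro J hJ x m h s hs t ht
  have hd : ∀ r ∈ J, HasDerivWithinAt (fun r => (polyA (x r) (m r)).eval l) 0 J r :=
    fun r hr => h.hasDerivWithinAt_eval_polyA hr hl
  simpa [sub_eq_zero] using
    hJ.convex.norm_image_sub_le_of_norm_hasDerivWithin_le (C := 0) hd (by simp) ht hs

theorem isConstantOfMotion_H (k : ℕ) : IsConstantOfMotion (n := n) (H k) := by
  intro J hJ x m h s hs t ht
  have polyA_eq : polyA (x s) (m s) = polyA (x t) (m t) :=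
    eq_of_infinite_eval_eq _ _ <| (Set.finite_singleton (0 : ℝ)).infinite_compl.mono fun l hl =>
      isConstantOfMotion_eval_polyA hl J hJ x m h s hs t ht
  simp only [H, polyA_eq]

end ConstantOfMotion

end NovikovPeakon

theorem mainTheorem3 (n : ℕ) :
    (∀ k ∈ Finset.Icc 1 n,
      NovikovPeakon.IsConstantOfMotion (n := n) (NovikovPeakon.H k)) ∧
    ∀ x m : Fin n → ℝ, StrictMono x →
      NovikovPeakon.polyA x m =
        ∑ k ∈ Finset.range (n + 1), C (NovikovPeakon.H k x m) * (-X) ^ k ∧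
      NovikovPeakon.H 0 x m = 1 ∧
      NovikovPeakon.polyA x m =
        (1 - (X : ℝ[X]) • (NovikovPeakon.matT n * NovikovPeakon.matP m * NovikovPeakon.matE x *
          NovikovPeakon.matP m).map C).det ∧
      NovikovPeakon.matP m * NovikovPeakon.matE x * NovikovPeakon.matP m =
        Matrix.of (fun j k => m j * m k * Real.exp (-|x j - x k|)) ∧
      (NovikovPeakon.matP m * NovikovPeakon.matE x * NovikovPeakon.matP m).IsSymm ∧
      ∀ k ∈ Finset.Icc 1 n,
        NovikovPeakon.H k x m =
          NovikovPeakon.sumMinors k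
            (NovikovPeakon.matP m * NovikovPeakon.matE x * NovikovPeakon.matP m) := by
  refine ⟨fun k _ => NovikovPeakon.isConstantOfMotion_H k, fun x m hx =>
    ⟨NovikovPeakon.polyA_eq_sum_H x m, NovikovPeakon.H_zero x m,
      NovikovPeakon.polyA_eq_det m hx.monotone,
      ext (NovikovPeakon.matP_mul_matE_mul_matP_apply x m), ?_,
      fun k _ => NovikovPeakon.H_eq_sumMinors m hx.monotone k⟩⟩
  rw [NovikovPeakon.matP_mul_matE_mul_matP_eq_onePairMatrix m hx.monotone]
  exact NovikovPeakon.isSymm_onePairMatrix _ _
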